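/- Let $\psi:\mathbb{R}^d\to(-\infty,\infty]$ be proper, closed (lower semicontinuous) and convex with $0<\int_{\mathbb{R}^d} e^{-\psi(x)}\,dx<\infty$, and let $\pi\propto e^{-\psi}$. For $\lambda>0$ let $\psi^\lambda(x)=\inf_{y}\{\psi(y)+\tfrac{1}{2\lambda}\|y-x\|^2\}$ be the Moreau--Yosida envelope, $\pi^\lambda\propto e^{-\psi^\lambda}$, and $w^\lambda(x)=e^{-\psi(x)}/e^{-\psi^\lambda(x)}$. Let $\xi:\mathbb{R}^d\to\mathbb{R}^p$ be measurable and $\pi$-integrable, $\theta=\mathbb{E}_\pi[\xi(X)]$, and $S(x)=(\xi(x)^{\top}w^\lambda(x),\,w^\lambda(x))^{\top}\in\mathbb{R}^{p+1}$. Let $\{X_t\}_{t\ge1}$ be an irreducible, aperiodic and Harris recurrent time-homogeneous Markov chain on $\mathbb{R}^d$ with stationary density $\pi^\lambda$ and arbitrary initial distribution. Assume that $\mathbb{E}_{\pi^\lambda}\|S(X)\|^2<\infty$ and that the series $$\Sigma=\sum_{k=-\infty}^{\infty}\operatorname{Cov}_{\pi^\lambda}\big(S(X_1),S(X_{1+k})\big)$$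 converges (the covariances being those of the stationary chain, and convergence being that of the symmetric partial sums), and put $$\Xi=\frac{1}{[\mathbb{E}_{\pi^\lambda}w^\lambda(X_1)]^2}\,\begin{bmatrix}\mathbf I_p&-\theta\end{bmatrix}\Sigma\begin{bmatrix}\mathbf I_p\\-\theta^{\top}\end{bmatrix}.$$ With $$\hat\theta^{\rm MY}_n=\sum_{t=1}^n\frac{\xi(X_t)w^\lambda(X_t)}{\sum_{k=1}^n w^\lambda(X_k)},\qquad \bar w_n=\frac1n\sum_{t=1}^n w^\lambda(X_t),$$ and a sequence $\hat\Sigma_n$ of random $(p+1)\times(p+1)$ matrices, define the plug-in estimator $$\hat\Xi_n=\frac{1}{\bar w_n^2}\,\begin{bmatrix}\mathbf I_p&-\hat\theta^{\rm MY}_n\end{bmatrix}\hat\Sigma_n\begin{bmatrix}\mathbf I_p\\-(\hat\theta^{\rm MY}_n)^{\top}\end{bmatrix}.$$ If $\hat\Sigma_n$ is strongly consistent for $\Sigma$, i.e. $\hat\Sigma_n\to\Sigma$ almost surely, then $\hat\Xi_n\to\Xi$ almost surely as $n\to\infty$. -/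

import Mathlib

open MeasureTheory ProbabilityTheory Filter Topology
open scoped ENNReal

noncomputable section

namespace MYIS

/-- The class `Γ(ℝ^d)` of proper, closed (lower semicontinuous), convex functions
`ℝ^d → (-∞, ∞]`; convexity is convexity of the epigraph. -/
structure IsProperClosedConvex {d : ℕ} (ψ : EuclideanSpace ℝ (Fin d) → EReal) : Prop where
  ne_bot : ∀ x, ψ x ≠ ⊥
  exists_ne_top : ∃ x, ψ x ≠ ⊤
  lsc : LowerSemicontinuous ψ
  convex : Convex ℝ {q : EuclideanSpace ℝ (Fin d) × ℝ | ψ q.1 ≤ (q.2 : EReal)}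

/-- The Moreau-Yosida envelope `ψ^lam (x) = inf_y { ψ(y) + ‖y - x‖² / (2 lam) }`. -/
def moreauEnvelope {d : ℕ} (ψ : EuclideanSpace ℝ (Fin d) → EReal) (lam : ℝ) :
    EuclideanSpace ℝ (Fin d) → EReal :=
  fun x => ⨅ y, ψ y + ((‖y - x‖ ^ 2 / (2 * lam) : ℝ) : EReal)

/-- The normalizing constant `∫ e^{-φ(x)} dx`. -/
def normConst {d : ℕ} (φ : EuclideanSpace ℝ (Fin d) → EReal) : ℝ≥0∞ :=
  ∫⁻ x, EReal.exp (-φ x)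

/-- The distribution on `ℝ^d` with Lebesgue density proportional to `e^{-φ}`. -/
def gibbs {d : ℕ} (φ : EuclideanSpace ℝ (Fin d) → EReal) :
    Measure (EuclideanSpace ℝ (Fin d)) :=
  (volume : Measure (EuclideanSpace ℝ (Fin d))).withDensity
    (fun x => EReal.exp (-φ x) / normConst φ)

/-- The unnormalized importance weight `w^lam (x) = e^{-ψ(x)} / e^{-ψ^lam (x)}`. -/
def weight {d : ℕ} (ψ : EuclideanSpace ℝ (Fin d) → EReal) (lam : ℝ)
    (x : EuclideanSpace ℝ (Fin d)) : ℝ :=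
  (EReal.exp (-ψ x) / EReal.exp (-moreauEnvelope ψ lam x)).toReal

/-- The law on path space of the time-homogeneous Markov chain with transition kernel `κ` and
initial distribution `μ₀`. Time `0` is the first state of the chain. -/
def chainLaw {E : Type*} [MeasurableSpace E] (κ : Kernel E E) [IsMarkovKernel κ]
    (μ₀ : Measure E) : Measure (ℕ → E) :=
  Kernel.trajMeasure (X := fun _ : ℕ => E) μ₀
    (fun n => κ.comap (fun h : (i : Finset.Iic n) → E => h ⟨n, Finset.mem_Iic.2 le_rfl⟩)
      (measurable_pi_apply _))

/-- The process `X` on `(Ω, P)` is a time-homogeneous Markov chain with transition kernel `κ`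
(the initial distribution is arbitrary). -/
structure IsMarkovChain {Ω E : Type*} [MeasurableSpace Ω] [MeasurableSpace E] (P : Measure Ω)
    (κ : Kernel E E) [IsMarkovKernel κ] (X : ℕ → Ω → E) : Prop where
  measurable : ∀ t, Measurable (X t)
  law : P.map (fun ω t => X t ω) = chainLaw κ (P.map (X 0))

/-- Irreducibility: `φ`-irreducibility for some nontrivial `σ`-finite measure `φ`. -/
def IsIrreducibleChain {E : Type*} [MeasurableSpace E] (κ : Kernel E E) : Prop :=
  ∃ φ : Measure E, SigmaFinite φ ∧ φ ≠ 0 ∧ Kernel.IsIrreducible φ κ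

/-- Aperiodicity of a kernel with stationary distribution `μ`: there is no cycle of `m ≥ 2`
disjoint measurable sets of positive measure through which the chain moves deterministically. -/
def IsAperiodicChain {E : Type*} [MeasurableSpace E] (κ : Kernel E E) (μ : Measure E) : Prop :=
  ¬ ∃ m : ℕ, 2 ≤ m ∧ ∃ D : ZMod m → Set E,
    (∀ i, MeasurableSet (D i)) ∧ Pairwise (fun i j => Disjoint (D i) (D j)) ∧
      (∀ i, 0 < μ (D i)) ∧ ∀ i, ∀ x ∈ D i, κ x (D (i + 1)) = 1

/-- Harris recurrence of a kernel with stationary distribution `μ`: from every starting point,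
every measurable set of positive `μ`-measure is almost surely visited infinitely often. -/
def IsHarrisRecurrent {E : Type*} [MeasurableSpace E] (κ : Kernel E E) [IsMarkovKernel κ]
    (μ : Measure E) : Prop :=
  ∀ A : Set E, MeasurableSet A → 0 < μ A → ∀ x : E,
    ∀ᵐ path ∂(chainLaw κ (Measure.dirac x)), ∃ᶠ t in atTop, path t ∈ A

/-- `S(x) = (ξ(x) w^lam (x), w^lam (x)) ∈ ℝ^{p+1}`. -/
def statS {d p : ℕ} (ψ : EuclideanSpace ℝ (Fin d) → EReal) (lam : ℝ)
    (ξ : EuclideanSpace ℝ (Fin d) → EuclideanSpace ℝ (Fin p))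
    (x : EuclideanSpace ℝ (Fin d)) : Fin p ⊕ Unit → ℝ :=
  Sum.elim (fun i => ξ x i * weight ψ lam x) (fun _ => weight ψ lam x)

/-- The lag-`k` cross-covariance matrix, `k ∈ ℤ`, of the process `f(X_t)` when the chain is
started from `μ`; for stationary `μ` this is `Cov_μ(f(X_1), f(X_{1+k}))`. For negative `k` both
time indices are shifted by `-k`. -/
def lagCov {E ι : Type*} [MeasurableSpace E] (κ : Kernel E E) [IsMarkovKernel κ]
    (μ : Measure E) (f : E → ι → ℝ) (k : ℤ) : Matrix ι ι ℝ :=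
  Matrix.of fun i j =>
    covariance (fun path : ℕ → E => f (path (-k).toNat) i)
      (fun path : ℕ → E => f (path k.toNat) j) (chainLaw κ μ)

/-- `Sig` is the matrix `∑_{k=-∞}^{∞} Cov_μ(f(X_1), f(X_{1+k}))`: the components of `f` have
finite second moments under `μ`, so that the covariances are defined, and the symmetric partial
sums of the series converge to `Sig`. -/
structure IsAsymptoticCov {E ι : Type*} [MeasurableSpace E] (κ : Kernel E E) [IsMarkovKernel κ]
    (μ : Measure E) (f : E → ι → ℝ) (Sig : Matrix ι ι ℝ) : Prop where
  memLp : ∀ i, MemLp (fun x => f x i) 2 μ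
  tendsto : Tendsto (fun K : ℕ => ∑ k ∈ Finset.Icc (-(K : ℤ)) (K : ℤ), lagCov κ μ f k)
    atTop (𝓝 Sig)

/-- The `p × (p+1)` block matrix `[I_p  -θ]`. -/
def blockRow {p : ℕ} (θ : EuclideanSpace ℝ (Fin p)) : Matrix (Fin p) (Fin p ⊕ Unit) ℝ :=
  Matrix.fromCols 1 (Matrix.of fun i _ => -θ i)

/-- `v⁻² [I_p  -θ] Sig [I_p  -θ]ᵀ`. -/
def sandwich {p : ℕ} (v : ℝ) (θ : EuclideanSpace ℝ (Fin p))
    (Sig : Matrix (Fin p ⊕ Unit) (Fin p ⊕ Unit) ℝ) : Matrix (Fin p) (Fin p) ℝ :=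
  (1 / v ^ 2) • (blockRow θ * Sig * (blockRow θ).transpose)

/-- `θ = E_π[ξ(X)]`, where `π ∝ e^{-ψ}`. -/
def targetMean {d p : ℕ} (ψ : EuclideanSpace ℝ (Fin d) → EReal)
    (ξ : EuclideanSpace ℝ (Fin d) → EuclideanSpace ℝ (Fin p)) : EuclideanSpace ℝ (Fin p) :=
  ∫ x, ξ x ∂(gibbs ψ)

/-- `Ξ = (E_{π^lam} w^lam)⁻² [I_p  -θ] Sig [I_p  -θ]ᵀ`. -/
def limitCov {d p : ℕ} (ψ : EuclideanSpace ℝ (Fin d) → EReal) (lam : ℝ)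
    (ξ : EuclideanSpace ℝ (Fin d) → EuclideanSpace ℝ (Fin p))
    (Sig : Matrix (Fin p ⊕ Unit) (Fin p ⊕ Unit) ℝ) : Matrix (Fin p) (Fin p) ℝ :=
  sandwich (∫ x, weight ψ lam x ∂(gibbs (moreauEnvelope ψ lam))) (targetMean ψ ξ) Sig

/-- The mean weight of the first `n` states `x 0, …, x (n - 1)`. -/
def meanWeight {d : ℕ} (ψ : EuclideanSpace ℝ (Fin d) → EReal) (lam : ℝ) (n : ℕ)
    (x : ℕ → EuclideanSpace ℝ (Fin d)) : ℝ :=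
  (n : ℝ)⁻¹ * ∑ t ∈ Finset.range n, weight ψ lam (x t)

/-- The self-normalized Moreau-Yosida importance sampling estimator of `θ` based on the first `n`
states `x 0, …, x (n - 1)`. -/
def thetaMY {d p : ℕ} (ψ : EuclideanSpace ℝ (Fin d) → EReal) (lam : ℝ)
    (ξ : EuclideanSpace ℝ (Fin d) → EuclideanSpace ℝ (Fin p)) (n : ℕ)
    (x : ℕ → EuclideanSpace ℝ (Fin d)) : EuclideanSpace ℝ (Fin p) :=
  ∑ t ∈ Finset.range n,
    (weight ψ lam (x t) / ∑ k ∈ Finset.range n, weight ψ lam (x k)) • ξ (x t)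

/-- The plug-in estimator of `Ξ` based on the first `n` states and on a value `SigHat` of an
estimator of `Σ`. -/
def plugIn {d p : ℕ} (ψ : EuclideanSpace ℝ (Fin d) → EReal) (lam : ℝ)
    (ξ : EuclideanSpace ℝ (Fin d) → EuclideanSpace ℝ (Fin p)) (n : ℕ)
    (x : ℕ → EuclideanSpace ℝ (Fin d))
    (SigHat : Matrix (Fin p ⊕ Unit) (Fin p ⊕ Unit) ℝ) : Matrix (Fin p) (Fin p) ℝ :=
  sandwich (meanWeight ψ lam n x) (thetaMY ψ lam ξ n x) SigHat

/-- Strong consistency: the random sequence `est` converges almost surely to `a`. -/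
def StronglyConsistent {Ω F : Type*} [MeasurableSpace Ω] [TopologicalSpace F] (P : Measure Ω)
    (est : ℕ → Ω → F) (a : F) : Prop :=
  ∀ᵐ ω ∂P, Tendsto (fun n => est n ω) atTop (𝓝 a)

end MYIS

end

/-! The estimator is a continuous function of `SigHat` and of the averages of `w` and `ξ w`, so all
that is needed is a strong law for these averages and the values of their limits. The limits come
from importance sampling: reweighting `π^lam` by `w` gives `v • π`, with `v` the ratio of
normalizing constants, so the averages tend to `v` and `v θ`, and `v` cancels in the quotient
(`integral_mul_weight`). That `π^lam` is a probability measure has to be proved: convexity forces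
`ψ` to grow linearly (`exists_linear_lower_bound`), and the envelope inherits the slope. The strong
law rests on two facts. By Lévy's theorem and Harris recurrence, a shift invariant event has
probability zero from every start or one from every start (`zero_one`). If the partial sums of `a`
were unbounded above from every start, they would be so under the stationary law, and the maximal
ergodic inequality would give `a` a nonnegative mean. Hence a negative mean forces sums bounded
above (`ae_bddAbove_sum`); applying this to `f` and `-f`, recentred slightly above their means,
yields the limit from any initial distribution. -/

noncomputable section

namespace MYIS

/-! ### Path space, the Markov property and the zero-one law. -/

section PathSpace

/-- Append one state to a finite history. -/
def snocHist {E : Type*} (b : ℕ) (q : ((i : Finset.Iic b) → E) × E) : (i : Finset.Iic (b + 1)) → E :=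
  fun i => if h : (i : ℕ) ≤ b then q.1 ⟨i, Finset.mem_Iic.2 h⟩ else q.2

lemma snocHist_comp {E : Type*} (b : ℕ) :
    snocHist (E := E) b ∘ (fun x : ℕ → E => (Preorder.frestrictLe b x, x (b + 1))) =
      Preorder.frestrictLe (b + 1) := by
  funext x i
  have hi := Finset.mem_Iic.1 i.2
  by_cases h : (i : ℕ) ≤ b
  · simp [snocHist, h]
  · have : (i : ℕ) = b + 1 := by omega
    simp [snocHist, this]

lemma shift_preimage_of_invariant {E : Type*} {A : Set (ℕ → E)}
    (hinv : (fun y t => y (t + 1)) ⁻¹' A = A) (n : ℕ) :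
    (fun (y : ℕ → E) t => y (n + t)) ⁻¹' A = A := by
  induction n with
  | zero => simp
  | succ n ih =>
    conv_rhs => rw [← ih, ← hinv]
    ext y
    have : (fun t => y (n + 1 + t)) = fun t => y (n + (t + 1)) := by
      funext t; congr 1; omega
    simp only [Set.mem_preimage, this]

variable {E : Type*} [MeasurableSpace E] (κ : Kernel E E)

/-- The transition kernel `κ` as a kernel from the history up to time `n`. -/
abbrev histKernel (n : ℕ) : Kernel ((i : Finset.Iic n) → E) E :=
  κ.comap (fun h : (i : Finset.Iic n) → E => h ⟨n, Finset.mem_Iic.2 le_rfl⟩)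
    (measurable_pi_apply _)

variable [IsMarkovKernel κ]

/-- The law of the trajectory of the chain as a function of the starting point. -/
def pathKernel : Kernel E (ℕ → E) :=
  (Kernel.traj (X := fun _ : ℕ => E) (histKernel κ) 0).comap
    (fun x (_ : Finset.Iic 0) => x) (by fun_prop)

instance : IsMarkovKernel (pathKernel κ) := by unfold pathKernel; infer_instance

lemma pathKernel_apply (x : E) :
    pathKernel κ x = Kernel.traj (X := fun _ : ℕ => E) (histKernel κ) 0 (fun _ => x) := rfl

lemma chainLaw_eq_comp (μ : Measure E) : chainLaw κ μ = pathKernel κ ∘ₘ μ := by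
  have h : pathKernel κ = (Kernel.traj (X := fun _ : ℕ => E) (histKernel κ) 0) ∘ₖ
      Kernel.deterministic (fun x (_ : Finset.Iic 0) => x) (by fun_prop) := by
    rw [Kernel.comp_deterministic_eq_comap]; rfl
  rw [h, ← Measure.comp_assoc, Measure.deterministic_comp_eq_map]
  rfl

lemma chainLaw_dirac (x : E) : chainLaw κ (Measure.dirac x) = pathKernel κ x := by
  rw [chainLaw_eq_comp, Measure.dirac_bind (Kernel.measurable _)]

instance (μ : Measure E) [IsProbabilityMeasure μ] : IsProbabilityMeasure (chainLaw κ μ) := by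
  rw [chainLaw_eq_comp]; infer_instance

variable {κ}

lemma measurable_snocHist (b : ℕ) : Measurable (snocHist (E := E) b) := by
  refine measurable_pi_lambda _ fun i => ?_
  by_cases h : (i : ℕ) ≤ b
  · simp only [snocHist, h, dite_true]; fun_prop
  · simp only [snocHist, h, dite_false]; fun_prop

/-- A law on path space is determined by its starting point and its one-step transitions. -/
lemma eq_pathKernel {ν : Measure (ℕ → E)} {x : E}
    (h0 : ν.map (Preorder.frestrictLe 0) = Measure.dirac fun _ => x)
    (hstep : ∀ b, ν.map (fun y => (Preorder.frestrictLe b y, y (b + 1))) =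
      ν.map (Preorder.frestrictLe b) ⊗ₘ histKernel κ b) :
    ν = pathKernel κ x := by
  have key : ∀ b, ν.map (Preorder.frestrictLe b) =
      (pathKernel κ x).map (Preorder.frestrictLe b) := by
    intro b
    induction b with
    | zero =>
      rw [h0, pathKernel_apply, Kernel.traj_map_frestrictLe_apply, Kernel.partialTraj_self,
        Kernel.id_apply]
    | succ b ih =>
      rw [← snocHist_comp, ← Measure.map_map (measurable_snocHist b) (by fun_prop),
        ← Measure.map_map (measurable_snocHist b) (by fun_prop), hstep, ih, pathKernel_apply,
        ← Kernel.partialTraj_compProd_eq_map_traj (zero_le), Kernel.traj_map_frestrictLe_apply]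
  have hproj := Kernel.isProjectiveLimit_trajFun (X := fun _ : ℕ => E) (histKernel κ) 0
    (fun _ => x)
  -- Equal finite-dimensional marginals suffice, since the projective limit is unique.
  rw [pathKernel_apply, Kernel.traj_apply]
  have hfinite (I : Finset ℕ) : IsFiniteMeasure (inducedFamily (X := fun _ : ℕ => E) (fun n =>
      Kernel.partialTraj (X := fun _ : ℕ => E) (histKernel κ) 0 n (fun _ => x)) I) := by
    rw [inducedFamily]; infer_instance
  refine (hproj.unique ?_).symm
  rw [isProjectiveLimit_nat_iff
    (Kernel.isProjectiveMeasureFamily_partialTraj (X := fun _ : ℕ => E) (histKernel κ) _)]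
  intro n
  rw [key, inducedFamily_Iic, pathKernel_apply, Kernel.traj_map_frestrictLe_apply]

/-- The history of the last `b + 1` states of a history of `n + b + 1` states. -/
def lastHist (n b : ℕ) (h : (i : Finset.Iic (n + b)) → E) : (i : Finset.Iic b) → E :=
  fun i => h ⟨n + i, Finset.mem_Iic.2 (by have := Finset.mem_Iic.1 i.2; omega)⟩

lemma measurable_lastHist (n b : ℕ) : Measurable (lastHist (E := E) n b) := by
  unfold lastHist; fun_prop

/-- Markov property: the future after time `n` given the history `h` is a chain started from the
last state of `h`. -/
lemma map_shift_traj (n : ℕ) (h : (i : Finset.Iic n) → E) :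
    (Kernel.traj (X := fun _ : ℕ => E) (histKernel κ) n h).map (fun y t => y (n + t)) =
      pathKernel κ (h ⟨n, Finset.mem_Iic.2 le_rfl⟩) := by
  refine eq_pathKernel ?_ fun b => ?_
  · rw [Measure.map_map (by fun_prop) (by fun_prop)]
    have : (Preorder.frestrictLe 0 ∘ fun (y : ℕ → E) t => y (n + t)) =
        (fun (g : (i : Finset.Iic n) → E) (_ : Finset.Iic 0) => g ⟨n, Finset.mem_Iic.2 le_rfl⟩) ∘
          (Preorder.frestrictLe n) := by
      funext y i
      have hi : (i : ℕ) = 0 := by simpa using Finset.mem_Iic.1 i.2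
      simp [hi]
    rw [this, ← Measure.map_map (by fun_prop) (by fun_prop), Kernel.traj_map_frestrictLe_apply,
      Kernel.partialTraj_self, Kernel.id_apply]
    exact Measure.map_dirac' (by fun_prop) _
  · rw [Measure.map_map (by fun_prop) (by fun_prop), Measure.map_map (by fun_prop) (by fun_prop)]
    have e1 : ((fun y : ℕ → E => (Preorder.frestrictLe b y, y (b + 1))) ∘ fun y t => y (n + t)) =
        Prod.map (lastHist n b) id ∘
          fun y : ℕ → E => (Preorder.frestrictLe (n + b) y, y (n + b + 1)) := rfl
    have e2 : (Preorder.frestrictLe b ∘ fun (y : ℕ → E) t => y (n + t)) =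
        lastHist n b ∘ Preorder.frestrictLe (n + b) := rfl
    rw [e1, e2, ← Measure.map_map ((measurable_lastHist n b).prodMap measurable_id) (by fun_prop),
      ← Measure.map_map (measurable_lastHist n b) (by fun_prop),
      ← Kernel.partialTraj_compProd_eq_map_traj (Nat.le_add_right n b),
      Kernel.traj_map_frestrictLe_apply]
    ext s hs
    have hm := (measurable_lastHist (E := E) n b)
    rw [Measure.map_apply (hm.prodMap measurable_id) hs,
      Measure.compProd_apply ((hm.prodMap measurable_id) hs), Measure.compProd_apply hs,
      lintegral_map (Kernel.measurable_kernel_prodMk_left hs) hm]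
    -- `histKernel` sees only the last state, and `lastHist` keeps it: index `b` of the short
    -- history is index `n + b` of the long one.
    rfl

/-- The first transition moves the initial law to `κ ∘ₘ μ`, and by the Markov property at time `1`
the rest is a fresh chain. For invariant `μ` this makes the shift measure preserving. -/
lemma chainLaw_map_shift (μ : Measure E) :
    (chainLaw κ μ).map (fun y t => y (t + 1)) = chainLaw κ (κ ∘ₘ μ) := by
  have hs : Measurable (fun (y : ℕ → E) t => y (t + 1)) := by fun_prop
  rw [chainLaw_eq_comp, chainLaw_eq_comp, Measure.map_comp _ _ hs, Measure.comp_assoc]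
  congr 1
  ext1 x
  rw [Kernel.map_apply _ hs, pathKernel_apply,
    ← Kernel.traj_comp_partialTraj (X := fun _ : ℕ => E) (κ := histKernel κ) zero_le (b := 1),
    Kernel.comp_apply, Measure.map_comp _ _ hs]
  have h1 : (Kernel.traj (X := fun _ : ℕ => E) (histKernel κ) 1).map
      (fun (y : ℕ → E) t => y (t + 1)) = (pathKernel κ).comap
        (fun h : (i : Finset.Iic 1) → E => h ⟨1, Finset.mem_Iic.2 le_rfl⟩) (by fun_prop) := by
    ext1 h
    rw [Kernel.map_apply _ hs, Kernel.comap_apply, ← map_shift_traj]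
    simp_rw [add_comm]
  rw [h1, ← Kernel.comp_deterministic_eq_comap, ← Measure.comp_assoc,
    Measure.deterministic_comp_eq_map, Kernel.comp_apply]
  congr 1
  rw [← Kernel.map_apply _ (by fun_prop)]
  have := Kernel.map_partialTraj_succ_self (X := fun _ : ℕ => E) (κ := histKernel κ) 0
  simp only [zero_add] at this
  rw [this]
  rfl

lemma iSup_piLE : (⨆ n, (Filtration.piLE (X := fun _ : ℕ => E)) n : MeasurableSpace (ℕ → E)) =
    MeasurableSpace.pi := by
  refine le_antisymm (iSup_le fun n => Filtration.le _ n) ?_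
  refine iSup_le fun n => le_trans ?_ (le_iSup _ n)
  rw [Filtration.piLE_eq_comap_frestrictLe]
  rw [← measurable_iff_comap_le]
  have : (fun y : ℕ → E => y n) = (fun g : (i : Finset.Iic n) → E =>
    g ⟨n, Finset.mem_Iic.2 le_rfl⟩) ∘ Preorder.frestrictLe n := rfl
  rw [this]
  exact (measurable_pi_apply _).comp (comap_measurable _)

/-- Along almost every trajectory, the probability of a shift invariant event as a function of the
current state converges to the indicator of the event. -/
lemma ae_tendsto_indicator_of_invariant {A : Set (ℕ → E)} (hA : MeasurableSet A)
    (hinv : (fun y t => y (t + 1)) ⁻¹' A = A) (x : E) :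
    ∀ᵐ y ∂(pathKernel κ x), Tendsto (fun n => (pathKernel κ (y n)).real A) atTop
      (𝓝 (A.indicator 1 y)) := by
  have hint : Integrable (A.indicator (1 : (ℕ → E) → ℝ)) (pathKernel κ x) :=
    (integrable_const (1 : ℝ)).indicator hA
  -- Lévy's upward theorem; the limit is the indicator itself because the histories generate the
  -- whole product σ-algebra.
  have hlevy := hint.tendsto_ae_condExp (ℱ := Filtration.piLE (X := fun _ : ℕ => E)) (by
    rw [iSup_piLE]
    exact (stronglyMeasurable_one).indicator hA)
  have hall : ∀ᵐ y ∂(pathKernel κ x), ∀ n,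
      ((pathKernel κ x)[A.indicator (1 : (ℕ → E) → ℝ) |
        Filtration.piLE (X := fun _ : ℕ => E) n]) y = (pathKernel κ (y n)).real A := by
    rw [ae_all_iff]
    intro n
    have := Kernel.condExp_traj (X := fun _ : ℕ => E) (κ := histKernel κ) (zero_le (a := n)) hint
    filter_upwards [this] with y hy
    rw [pathKernel_apply, hy, integral_indicator_one hA]
    have hm := map_shift_traj (κ := κ) n (Preorder.frestrictLe n y)
    simp only [Preorder.frestrictLe_apply] at hm
    rw [← hm, map_measureReal_apply (by fun_prop) hA, shift_preimage_of_invariant hinv]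
  filter_upwards [hlevy, hall] with y h1 h2
  simpa only [h2] using h1

/-- Zero-one law for shift invariant events of a Harris recurrent chain, uniform in the starting
point. -/
lemma IsHarrisRecurrent.zero_one {μ : Measure E} [NeZero μ] (hH : IsHarrisRecurrent κ μ)
    {A : Set (ℕ → E)} (hA : MeasurableSet A) (hinv : (fun y t => y (t + 1)) ⁻¹' A = A) :
    (∀ x, ∀ᵐ y ∂(pathKernel κ x), y ∈ A) ∨ (∀ x, ∀ᵐ y ∂(pathKernel κ x), y ∉ A) := by
  have hmeas : Measurable fun x => (pathKernel κ x).real A :=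
    (Kernel.measurable_coe _ hA).ennreal_toReal
  -- Any threshold strictly between the two possible limits `0` and `1` would do. Either `B` or its
  -- complement is charged by `μ`, hence visited infinitely often from every start, which decides
  -- the limit.
  set B : Set E := {x | 1 / 2 ≤ (pathKernel κ x).real A}
  have hB : MeasurableSet B := measurableSet_le measurable_const hmeas
  by_cases hμ : 0 < μ B
  · left
    intro x
    have h1 := hH B hB hμ x
    rw [chainLaw_dirac] at h1
    filter_upwards [h1, ae_tendsto_indicator_of_invariant hA hinv x] with y hy hlim
    have := ge_of_tendsto_of_frequently hlim hy
    by_contra hyA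
    rw [Set.indicator_of_notMem hyA] at this
    norm_num at this
  · right
    intro x
    have hc : 0 < μ Bᶜ := by
      rw [pos_iff_ne_zero]
      intro h0
      have : μ Set.univ = 0 := by
        rw [← Set.union_compl_self B, measure_union_null_iff]
        exact ⟨by simpa using hμ, h0⟩
      exact NeZero.ne μ (Measure.measure_univ_eq_zero.1 this)
    have h1 := hH Bᶜ hB.compl hc x
    rw [chainLaw_dirac] at h1
    filter_upwards [h1, ae_tendsto_indicator_of_invariant hA hinv x] with y hy hlim
    have := le_of_tendsto_of_frequently hlim (hy.mono fun n (hn : ¬ _ ≤ _) => (not_le.1 hn).le)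
    intro hyA
    rw [Set.indicator_of_mem hyA] at this
    norm_num at this

end PathSpace

/-! ### The maximal ergodic inequality. -/

section Ergodic

/-- The running maximum `max (0, S₁, …, Sₙ)` of the Birkhoff sums `Sₖ` of `g` along `T`. -/
def birkhoffMax {α : Type*} (T : α → α) (g : α → ℝ) : ℕ → α → ℝ
  | 0 => fun _ => 0
  | n + 1 => fun x => max 0 (g x + birkhoffMax T g n (T x))

lemma birkhoffMax_nonneg {α : Type*} (T : α → α) (g : α → ℝ) (n : ℕ) (x : α) :
    0 ≤ birkhoffMax T g n x := by
  cases n with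
  | zero => exact le_rfl
  | succ n => exact le_max_left _ _

lemma birkhoffMax_le_succ {α : Type*} (T : α → α) (g : α → ℝ) (n : ℕ) (x : α) :
    birkhoffMax T g n x ≤ birkhoffMax T g (n + 1) x := by
  induction n generalizing x with
  | zero => exact birkhoffMax_nonneg T g 1 x
  | succ n ih => exact max_le_max le_rfl (by simpa using ih (T x))

lemma birkhoffSum_le_birkhoffMax {α : Type*} (T : α → α) (g : α → ℝ) (n : ℕ) (x : α) :
    birkhoffSum T g n x ≤ birkhoffMax T g n x := by
  induction n generalizing x with
  | zero => simp [birkhoffMax]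
  | succ n ih =>
    rw [birkhoffSum_succ']
    exact le_max_of_le_right (by simpa using ih (T x))

lemma integrable_birkhoffMax {α : Type*} [MeasurableSpace α] {Q : Measure α} {T : α → α}
    (hT : MeasurePreserving T Q Q) {g : α → ℝ} (hg : Integrable g Q) (n : ℕ) :
    Integrable (birkhoffMax T g n) Q := by
  induction n with
  | zero => exact integrable_zero _ _ _
  | succ n ih => exact (integrable_zero _ _ _).sup (hg.add (hT.integrable_comp_of_integrable ih))

/-- Maximal ergodic inequality in the case where almost all sequences of Birkhoff sums are
unbounded above. -/
lemma integral_nonneg_of_ae_not_bddAbove_birkhoffSum {α : Type*} [MeasurableSpace α]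
    {Q : Measure α} {T : α → α} (hT : MeasurePreserving T Q Q) {g : α → ℝ} (hg : Integrable g Q)
    (h : ∀ᵐ x ∂Q, ¬ BddAbove (Set.range fun n => birkhoffSum T g n x)) :
    0 ≤ ∫ x, g x ∂Q := by
  have hM := integrable_birkhoffMax hT hg
  -- By invariance `D n` integrates to that of a nonnegative increment of the running maximum. It
  -- also equals `max (-Mₙ ∘ T) g`, which is dominated by `|g|` and becomes `g` once `Mₙ (T x) ≥ -g
  -- x`.
  set D : ℕ → α → ℝ := fun n x => birkhoffMax T g (n + 1) x - birkhoffMax T g n (T x) with hD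
  have hDeq : ∀ n x, D n x = max (-birkhoffMax T g n (T x)) (g x) := by
    intro n x
    simp only [hD, birkhoffMax]
    rw [← max_sub_sub_right]; simp
  have hTM : ∀ n, Integrable (fun x => birkhoffMax T g n (T x)) Q := fun n =>
    hT.integrable_comp_of_integrable (hM n)
  have hDnonneg : ∀ n, 0 ≤ ∫ x, D n x ∂Q := by
    intro n
    simp only [hD]
    rw [integral_sub (hM _) (hTM _)]
    have : ∫ x, birkhoffMax T g n (T x) ∂Q = ∫ x, birkhoffMax T g n x ∂Q := by
      have h1 := (hM n).1
      rw [← hT.map_eq] at h1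
      rw [← integral_map hT.measurable.aemeasurable h1, hT.map_eq]
    rw [this, sub_nonneg]
    exact integral_mono (hM _) (hM _) (birkhoffMax_le_succ T g n)
  refine ge_of_tendsto' (f := fun n => ∫ x, D n x ∂Q) (x := atTop) ?_ hDnonneg
  refine tendsto_integral_of_dominated_convergence (fun x => |g x|)
    (fun n => ((hM _).sub (hTM _)).1) hg.abs (fun n => ae_of_all _ fun x => ?_) ?_
  · rw [hDeq, Real.norm_eq_abs]
    have := birkhoffMax_nonneg T g n (T x)
    refine abs_le.2 ⟨?_, ?_⟩
    · exact le_max_of_le_right (neg_abs_le _)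
    · exact max_le (by have := abs_nonneg (g x); linarith) (le_abs_self _)
  · filter_upwards [hT.quasiMeasurePreserving.ae h] with x hx
    refine tendsto_const_nhds.congr' ?_
    obtain ⟨n, hn⟩ : ∃ n, -g x ≤ birkhoffSum T g n (T x) := by
      by_contra! hcon
      exact hx ⟨-g x, by rintro _ ⟨n, rfl⟩; exact (hcon n).le⟩
    filter_upwards [eventually_ge_atTop n] with m hm
    rw [hDeq, max_eq_right]
    have h1 := monotone_nat_of_le_succ (f := fun n => birkhoffMax T g n (T x))
      (fun n => birkhoffMax_le_succ T g n (T x)) hm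
    have h2 := birkhoffSum_le_birkhoffMax T g n (T x)
    simp only at h1
    linarith

/-! ### Boundedness of partial sums along a path. -/

lemma birkhoffSum_shift {E : Type*} (a : E → ℝ) (n : ℕ) (y : ℕ → E) :
    birkhoffSum (fun (y : ℕ → E) t => y (t + 1)) (fun y => a (y 0)) n y =
      ∑ k ∈ Finset.range n, a (y k) := by
  have : ∀ k, (fun (y : ℕ → E) t => y (t + 1))^[k] y = fun t => y (t + k) := by
    intro k
    induction k with
    | zero => rfl
    | succ k ih =>
      rw [Function.iterate_succ_apply', ih]
      funext t
      simp only [add_assoc, add_comm k 1]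
  simp [birkhoffSum, this]

/-- The paths along which the partial sums of `a` are unbounded above. -/
def unboundedSums {E : Type*} (a : E → ℝ) : Set (ℕ → E) :=
  {y | ¬ BddAbove (Set.range fun n => ∑ k ∈ Finset.range n, a (y k))}

/-- Dropping the first state changes every nonempty sum by the constant `a (y 0)`, so the zero-one
law applies to this event. -/
lemma preimage_shift_unboundedSums {E : Type*} (a : E → ℝ) :
    (fun y t => y (t + 1)) ⁻¹' unboundedSums a = unboundedSums a := by
  ext y
  simp only [unboundedSums, Set.mem_preimage, Set.mem_ofPred_eq, not_iff_not]
  have hs : ∀ n, ∑ k ∈ Finset.range (n + 1), a (y k) =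
      ∑ k ∈ Finset.range n, a (y (k + 1)) + a (y 0) := fun n => Finset.sum_range_succ' _ _
  constructor
  · rintro ⟨C, hC⟩
    -- The `0` covers the empty sum.
    refine ⟨max 0 (C + a (y 0)), ?_⟩
    rintro _ ⟨n, rfl⟩
    cases n with
    | zero => simp
    | succ n =>
      refine le_max_of_le_right ?_
      simp only [hs]
      have := hC ⟨n, rfl⟩
      simp only at this
      linarith
  · rintro ⟨C, hC⟩
    refine ⟨C - a (y 0), ?_⟩
    rintro _ ⟨n, rfl⟩
    have := hC ⟨n + 1, rfl⟩
    simp only [hs] at this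
    simp only
    linarith

lemma measurableSet_unboundedSums {E : Type*} [MeasurableSpace E] {a : E → ℝ}
    (ha : Measurable a) : MeasurableSet (unboundedSums a) := by
  refine MeasurableSet.compl ?_
  have hm : ∀ n : ℕ, Measurable fun y : ℕ → E => ∑ k ∈ Finset.range n, a (y k) := fun n => by
    fun_prop
  exact measurableSet_bddAbove_range hm

/-- Averages are controlled by boundedness of the recentred partial sums. -/
lemma tendsto_average_of_bddAbove {u : ℕ → ℝ} {m : ℝ}
    (h1 : ∀ j : ℕ, BddAbove (Set.range fun n =>
      ∑ k ∈ Finset.range n, (u k - (m + 1 / ((j : ℝ) + 1)))))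
    (h2 : ∀ j : ℕ, BddAbove (Set.range fun n =>
      ∑ k ∈ Finset.range n, (-u k - (-m + 1 / ((j : ℝ) + 1))))) :
    Tendsto (fun n : ℕ => (n : ℝ)⁻¹ * ∑ k ∈ Finset.range n, u k) atTop (𝓝 m) := by
  rw [Metric.tendsto_atTop]
  intro ε hε
  obtain ⟨j, hj⟩ := exists_nat_one_div_lt (half_pos hε)
  obtain ⟨C, hC⟩ := h1 j
  obtain ⟨C', hC'⟩ := h2 j
  obtain ⟨N, hN⟩ := exists_nat_gt (max 0 (max C C') / (ε / 2))
  -- Half of `ε` absorbs the recentring `1 / (j + 1)`, the other half the bounds `C`, `C'` divided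
  -- by `n`; the `+ 1` keeps `n` positive.
  refine ⟨N + 1, fun n hn => ?_⟩
  have hn' : (N : ℝ) + 1 ≤ n := by exact_mod_cast hn
  have hn0 : (0 : ℝ) < n := by linarith [(Nat.cast_nonneg N : (0 : ℝ) ≤ N)]
  have a1 := hC ⟨n, rfl⟩
  have a2 := hC' ⟨n, rfl⟩
  simp only [Finset.sum_sub_distrib, Finset.sum_neg_distrib, Finset.sum_const, Finset.card_range,
    nsmul_eq_mul] at a1 a2
  rw [div_lt_iff₀ (half_pos hε)] at hN
  have b1 : C ≤ max 0 (max C C') := le_max_of_le_right (le_max_left _ _)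
  have b2 : C' ≤ max 0 (max C C') := le_max_of_le_right (le_max_right _ _)
  have b3 : (N : ℝ) * (ε / 2) ≤ n * (ε / 2) := by gcongr; linarith
  have b4 : (n : ℝ) * (1 / ((j : ℝ) + 1)) < n * (ε / 2) := by gcongr
  rw [Real.dist_eq, abs_lt]
  set s := ∑ k ∈ Finset.range n, u k
  have e : (n : ℝ)⁻¹ * s - m = (s - n * m) / n := by field_simp
  rw [e, lt_div_iff₀ hn0, div_lt_iff₀ hn0]
  constructor <;> nlinarith

/-! ### The strong law for Harris recurrent chains. -/

variable {E : Type*} [MeasurableSpace E] {κ : Kernel E E} [IsMarkovKernel κ]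

lemma chainLaw_map_zero (μ : Measure E) : (chainLaw κ μ).map (fun y => y 0) = μ := by
  have h0 : Measurable (fun y : ℕ → E => y 0) := measurable_pi_apply 0
  rw [chainLaw_eq_comp, Measure.map_comp _ _ h0]
  have : (pathKernel κ).map (fun y => y 0) = Kernel.id := by
    ext1 x
    have e : (fun y : ℕ → E => y 0) = (fun g : (i : Finset.Iic 0) → E =>
      g ⟨0, Finset.mem_Iic.2 le_rfl⟩) ∘ Preorder.frestrictLe 0 := rfl
    rw [Kernel.map_apply _ h0, e, ← Measure.map_map (by fun_prop) (by fun_prop), pathKernel_apply,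
      Kernel.traj_map_frestrictLe_apply, Kernel.partialTraj_self, Kernel.id_apply, Kernel.id_apply]
    exact Measure.map_dirac' (by fun_prop) _
  rw [this, Measure.id_comp]

/-- Along a Harris recurrent chain the partial sums of a function with negative mean are almost
surely bounded above. -/
lemma IsHarrisRecurrent.ae_bddAbove_sum {μ : Measure E} [IsProbabilityMeasure μ]
    (hH : IsHarrisRecurrent κ μ) (hinv : κ.Invariant μ) {a : E → ℝ} (ha : Measurable a)
    (hint : Integrable a μ) (hneg : ∫ x, a x ∂μ < 0) (x : E) :
    ∀ᵐ y ∂(pathKernel κ x), BddAbove (Set.range fun n => ∑ k ∈ Finset.range n, a (y k)) := by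
  rcases hH.zero_one (measurableSet_unboundedSums ha) (preimage_shift_unboundedSums a) with h | h
  -- Unboundedness from every start passes to the stationary law, where the maximal inequality
  -- contradicts the negative mean.
  · exfalso
    have hT : MeasurePreserving (fun (y : ℕ → E) t => y (t + 1)) (chainLaw κ μ)
        (chainLaw κ μ) := ⟨by fun_prop, by rw [chainLaw_map_shift, hinv.def]⟩
    have h0 : MeasurePreserving (fun y : ℕ → E => y 0) (chainLaw κ μ) μ :=
      ⟨measurable_pi_apply 0, chainLaw_map_zero μ⟩
    have hae : ∀ᵐ y ∂(chainLaw κ μ), ¬ BddAbove (Set.range fun n =>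
        birkhoffSum (fun (y : ℕ → E) t => y (t + 1)) (fun y => a (y 0)) n y) := by
      simp only [birkhoffSum_shift]
      change ∀ᵐ y ∂(chainLaw κ μ), y ∈ unboundedSums a
      rw [chainLaw_eq_comp]
      exact Measure.ae_comp_of_ae_ae (measurableSet_unboundedSums ha) (ae_of_all _ h)
    have := integral_nonneg_of_ae_not_bddAbove_birkhoffSum hT
      (h0.integrable_comp_of_integrable hint) hae
    have e : ∫ y, a (y 0) ∂(chainLaw κ μ) = ∫ x, a x ∂μ := by
      rw [← integral_map (φ := fun y : ℕ → E => y 0) h0.measurable.aemeasurable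
        ha.aestronglyMeasurable, chainLaw_map_zero]
    simp only [Function.comp_def] at this
    linarith
  · filter_upwards [h x] with y hy
    exact not_not.1 hy

/-- Strong law of large numbers for a Harris recurrent chain started at an arbitrary point. -/
theorem IsHarrisRecurrent.ae_tendsto_average {μ : Measure E} [IsProbabilityMeasure μ]
    (hH : IsHarrisRecurrent κ μ) (hinv : κ.Invariant μ) {f : E → ℝ} (hf : Measurable f)
    (hint : Integrable f μ) (x : E) :
    ∀ᵐ y ∂(pathKernel κ x), Tendsto (fun n : ℕ => (n : ℝ)⁻¹ * ∑ k ∈ Finset.range n, f (y k)) atTop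
      (𝓝 (∫ x, f x ∂μ)) := by
  have h1 : ∀ᵐ y ∂(pathKernel κ x), ∀ j : ℕ, BddAbove (Set.range fun n =>
      ∑ k ∈ Finset.range n, (f (y k) - (∫ x, f x ∂μ + 1 / ((j : ℝ) + 1)))) := by
    rw [ae_all_iff]
    intro j
    refine hH.ae_bddAbove_sum hinv (a := fun x => f x - _) (hf.sub_const _)
      (hint.sub (integrable_const _)) ?_ x
    rw [integral_sub hint (integrable_const _)]
    have : 0 < 1 / ((j : ℝ) + 1) := by positivity
    simp; simpa using this
  have h2 : ∀ᵐ y ∂(pathKernel κ x), ∀ j : ℕ, BddAbove (Set.range fun n =>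
      ∑ k ∈ Finset.range n, (-f (y k) - (-∫ x, f x ∂μ + 1 / ((j : ℝ) + 1)))) := by
    rw [ae_all_iff]
    intro j
    refine hH.ae_bddAbove_sum hinv (a := fun x => -f x - _) (hf.neg.sub_const _)
      (hint.neg.sub (integrable_const _)) ?_ x
    rw [integral_sub (f := fun x => -f x) hint.neg (integrable_const _), integral_neg]
    have : 0 < 1 / ((j : ℝ) + 1) := by positivity
    simp; simpa using this
  filter_upwards [h1, h2] with y a1 a2
  exact tendsto_average_of_bddAbove a1 a2

/-- Strong law of large numbers for a Harris recurrent chain with arbitrary initial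
distribution. -/
theorem IsMarkovChain.ae_tendsto_average {μ : Measure E} [IsProbabilityMeasure μ]
    (hH : IsHarrisRecurrent κ μ) (hinv : κ.Invariant μ) {f : E → ℝ} (hf : Measurable f)
    (hint : Integrable f μ) {Ω : Type*} [MeasurableSpace Ω] {P : Measure Ω} {X : ℕ → Ω → E}
    (hX : IsMarkovChain P κ X) :
    ∀ᵐ ω ∂P, Tendsto (fun n : ℕ => (n : ℝ)⁻¹ * ∑ k ∈ Finset.range n, f (X k ω)) atTop
      (𝓝 (∫ x, f x ∂μ)) := by
  have hm : MeasurableSet {y : ℕ → E | Tendsto (fun n : ℕ => (n : ℝ)⁻¹ *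
      ∑ k ∈ Finset.range n, f (y k)) atTop (𝓝 (∫ x, f x ∂μ))} :=
    measurableSet_tendsto _ fun n => by fun_prop
  have h : ∀ᵐ y ∂(P.map fun ω t => X t ω), Tendsto (fun n : ℕ => (n : ℝ)⁻¹ *
      ∑ k ∈ Finset.range n, f (y k)) atTop (𝓝 (∫ x, f x ∂μ)) := by
    rw [hX.law, chainLaw_eq_comp]
    exact Measure.ae_comp_of_ae_ae hm (ae_of_all _ (hH.ae_tendsto_average hinv hf hint))
  exact ae_of_ae_map (measurable_pi_lambda _ hX.measurable).aemeasurable h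

end Ergodic

/-! ### Linear growth of convex functions with integrable exponential. -/

section Convexity

/-- A convex set of finite volume which contains a ball is bounded. -/
lemma exists_subset_closedBall_of_convex {d : ℕ} {K : Set (EuclideanSpace ℝ (Fin d))}
    (hK : Convex ℝ K) {x₀ : EuclideanSpace ℝ (Fin d)} {r : ℝ} (hr : 0 < r)
    (hball : Metric.ball x₀ r ⊆ K) (hvol : volume K ≠ ⊤) :
    ∃ R, 0 ≤ R ∧ K ⊆ Metric.closedBall x₀ R := by
  set v := volume (Metric.ball (0 : EuclideanSpace ℝ (Fin d)) (r / 2)) with hv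
  have hvpos : v ≠ 0 := (Metric.measure_ball_pos volume _ (half_pos hr)).ne'
  obtain ⟨N, hN⟩ := ENNReal.exists_nat_mul_gt hvpos hvol
  refine ⟨2 * N * r, by positivity, fun y hy => ?_⟩
  rw [Metric.mem_closedBall, dist_eq_norm]
  by_contra! hD
  have hD0 : 0 < ‖y - x₀‖ := lt_of_le_of_lt (by positivity) hD
  set D := ‖y - x₀‖ with hDdef
  -- Centres spaced `r` apart in the first half of the segment to a far point `y`. There the convex
  -- hull of `y` and the ball around `x₀` still contains balls of radius `r / 2`; these are
  -- disjoint, and `N` of them exceed the volume of `K`.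
  let z : ℕ → EuclideanSpace ℝ (Fin d) := fun j => x₀ + ((j : ℝ) * r / D) • (y - x₀)
  have hsub : ∀ j ∈ Finset.range N, Metric.ball (z j) (r / 2) ⊆ K := by
    intro j hj w hw
    have hjN : (j : ℝ) ≤ N := by exact_mod_cast (Finset.mem_range.1 hj).le
    set t := (j : ℝ) * r / D with ht
    have ht0 : 0 ≤ t := by positivity
    have ht1 : t ≤ 1 / 2 := by
      rw [ht, div_le_iff₀ hD0]
      have : (j : ℝ) * r ≤ N * r := by gcongr
      linarith
    have h1t : 0 < 1 - t := by linarith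
    have hu : x₀ + (1 - t)⁻¹ • (w - z j) ∈ K := by
      apply hball
      rw [Metric.mem_ball, dist_eq_norm, add_sub_cancel_left, norm_smul, Real.norm_eq_abs,
        abs_of_pos (inv_pos.2 h1t), ← dist_eq_norm]
      have hw' := Metric.mem_ball.1 hw
      rw [inv_mul_lt_iff₀ h1t]
      nlinarith
    have := hK hu hy h1t.le ht0 (by ring)
    convert this using 1
    simp only [z, smul_add, smul_smul, mul_inv_cancel₀ h1t.ne', one_smul, ← ht]
    module
  have hdisj : (Finset.range N : Set ℕ).PairwiseDisjoint fun j => Metric.ball (z j) (r / 2) := by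
    intro i _ j _ hij
    apply Metric.ball_disjoint_ball
    have e : z i - z j = (((i : ℝ) - j) * (r / D)) • (y - x₀) := by simp only [z]; module
    rw [dist_eq_norm, e, norm_smul, ← hDdef, Real.norm_eq_abs, abs_mul,
      abs_of_pos (div_pos hr hD0), mul_assoc, div_mul_cancel₀ _ hD0.ne']
    have : (1 : ℝ) ≤ |(i : ℝ) - j| := by
      have : (1 : ℤ) ≤ |(i : ℤ) - j| := Int.one_le_abs (sub_ne_zero.2 (by exact_mod_cast hij))
      exact_mod_cast this
    nlinarith
  have hle : volume (⋃ j ∈ Finset.range N, Metric.ball (z j) (r / 2)) ≤ volume K :=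
    measure_mono (Set.iUnion₂_subset hsub)
  rw [measure_biUnion_finset hdisj (fun _ _ => Metric.isOpen_ball.measurableSet)] at hle
  have hc : ∀ j, volume (Metric.ball (z j) (r / 2)) = v := fun j =>
    Measure.addHaar_ball_center _ _ _
  simp only [hc, Finset.sum_const, Finset.card_range, nsmul_eq_mul] at hle
  exact absurd hN (not_lt.2 hle)

variable {d : ℕ} {ψ : EuclideanSpace ℝ (Fin d) → EReal}

lemma IsProperClosedConvex.le_combo (hψ : IsProperClosedConvex ψ)
    {x y : EuclideanSpace ℝ (Fin d)} {a b s t : ℝ} (hx : ψ x ≤ a) (hy : ψ y ≤ b) (hs : 0 ≤ s)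
    (ht : 0 ≤ t) (hst : s + t = 1) : ψ (s • x + t • y) ≤ ((s * a + t * b : ℝ) : EReal) :=
  hψ.convex (x := (x, a)) (y := (y, b)) hx hy hs ht hst

lemma IsProperClosedConvex.convex_sublevel (hψ : IsProperClosedConvex ψ) (c : ℝ) :
    Convex ℝ {x | ψ x ≤ c} := by
  intro x hx y hy s t hs ht hst
  have := hψ.le_combo hx hy hs ht hst
  rwa [← add_mul, hst, one_mul] at this

lemma IsProperClosedConvex.measurable (hψ : IsProperClosedConvex ψ) : Measurable ψ :=
  hψ.lsc.measurable

lemma measurable_exp_neg {φ : EuclideanSpace ℝ (Fin d) → EReal} (hφ : Measurable φ) :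
    Measurable fun x => EReal.exp (-φ x) :=
  EReal.measurable_exp.comp hφ.neg

/-- Otherwise each sublevel set lies in its own frontier, which is null by convexity; then `ψ = ⊤`
almost everywhere and the integral vanishes. -/
lemma IsProperClosedConvex.exists_ball_subset_sublevel (hψ : IsProperClosedConvex ψ)
    (hpos : 0 < normConst ψ) :
    ∃ (c : ℝ) (x₀ : EuclideanSpace ℝ (Fin d)) (r : ℝ), 0 < r ∧
      Metric.ball x₀ r ⊆ {x | ψ x ≤ c} := by
  by_contra! hcon
  have hnull : ∀ c : ℝ, volume {x | ψ x ≤ c} = 0 := by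
    intro c
    have hint : interior {x | ψ x ≤ c} = ∅ := by
      by_contra hne
      obtain ⟨x, hx⟩ := Set.nonempty_iff_ne_empty.2 hne
      obtain ⟨r, hr, hsub⟩ := Metric.isOpen_iff.1 isOpen_interior x hx
      exact hcon c x r hr (hsub.trans interior_subset)
    refine measure_mono_null ?_ ((hψ.convex_sublevel c).addHaar_frontier volume)
    rw [frontier, hint, Set.sdiff_empty]
    exact subset_closure
  have hzero : ∀ᵐ x, ψ x = ⊤ := by
    have : {x | ¬ ψ x = ⊤} ⊆ ⋃ n : ℕ, {x | ψ x ≤ ((n : ℝ) : EReal)} := by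
      intro x hx
      obtain ⟨n, hn⟩ := exists_nat_ge (ψ x).toReal
      refine Set.mem_iUnion.2 ⟨n, ?_⟩
      change ψ x ≤ _
      rw [← EReal.coe_toReal hx (hψ.ne_bot x)]
      exact_mod_cast hn
    exact measure_mono_null this (measure_iUnion_null fun n => hnull n)
  refine hpos.ne' ?_
  rw [normConst, lintegral_eq_zero_iff (measurable_exp_neg hψ.measurable)]
  filter_upwards [hzero] with x hx
  simp [hx]

/-- Markov's inequality for `e^{-ψ}` at height `e^{-c}`. -/
lemma IsProperClosedConvex.volume_sublevel_ne_top (hψ : IsProperClosedConvex ψ)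
    (hfin : normConst ψ < ⊤) (c : ℝ) : volume {x | ψ x ≤ c} ≠ ⊤ := by
  have h := meas_ge_le_lintegral_div (μ := volume) (f := fun x => EReal.exp (-ψ x))
    (ε := EReal.exp (-(c : EReal)))
    (measurable_exp_neg hψ.measurable).aemeasurable
    (by simp [← EReal.coe_neg, Real.exp_pos]) (by simp)
  have hsub : {x | ψ x ≤ c} ⊆ {x | EReal.exp (-(c : EReal)) ≤ EReal.exp (-ψ x)} := fun x hx =>
    EReal.exp_monotone (EReal.neg_le_neg_iff.2 hx)
  refine ((measure_mono hsub).trans_lt (h.trans_lt ?_)).ne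
  exact ENNReal.div_lt_top hfin.ne (by simp)

/-- A proper closed convex function with `0 < ∫ e^{-ψ} < ∞` grows at least linearly. -/
lemma IsProperClosedConvex.exists_linear_lower_bound (hψ : IsProperClosedConvex ψ)
    (hpos : 0 < normConst ψ) (hfin : normConst ψ < ⊤) :
    ∃ (a b : ℝ) (x₀ : EuclideanSpace ℝ (Fin d)), 0 < a ∧
      ∀ x, ((a * ‖x - x₀‖ - b : ℝ) : EReal) ≤ ψ x := by
  obtain ⟨c, x₀, r, hr, hball⟩ := hψ.exists_ball_subset_sublevel hpos
  have hmono : {x | ψ x ≤ c} ⊆ {x | ψ x ≤ ((c + 1 : ℝ) : EReal)} := fun x hx =>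
    le_trans (b := (c : EReal)) hx (EReal.coe_le_coe_iff.2 (by linarith))
  obtain ⟨R, hR, hsub⟩ := exists_subset_closedBall_of_convex (hψ.convex_sublevel (c + 1)) hr
    (hball.trans hmono) (hψ.volume_sublevel_ne_top hfin _)
  have hx₀ : ψ x₀ ≤ c := hball (Metric.mem_ball_self hr)
  obtain ⟨x₁, _, hx₁⟩ := LowerSemicontinuousOn.exists_isMinOn
    (s := Metric.closedBall x₀ (R + 1)) ⟨x₀, Metric.mem_closedBall_self (by linarith)⟩
    (isCompact_closedBall _ _) (hψ.lsc.lowerSemicontinuousOn _)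
  obtain ⟨m, hm⟩ : ∃ m : ℝ, (m : EReal) < ψ x₁ := by
    obtain ⟨m, _, hm⟩ := EReal.lt_iff_exists_real_btwn.1 (bot_lt_iff_ne_bot.2 (hψ.ne_bot x₁))
    exact ⟨m, hm⟩
  have hR1 : 0 < R + 1 := by linarith
  -- Within radius `R + 1` the linear term is at most `1` and `ψ ≥ m`, whence `1 - m`; outside, `-c`
  -- comes from the bound `c + ‖x - x₀‖ / (R + 1)`.
  refine ⟨1 / (R + 1), max (-c) (1 - m), x₀, by positivity, fun x => ?_⟩
  rcases le_or_gt ‖x - x₀‖ (R + 1) with h | h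
  · have h1 : (m : EReal) ≤ ψ x :=
      hm.le.trans (hx₁ (by rwa [Metric.mem_closedBall, dist_eq_norm]))
    refine le_trans (EReal.coe_le_coe_iff.2 ?_) h1
    have h2 : 1 / (R + 1) * ‖x - x₀‖ ≤ 1 := by
      rw [one_div, inv_mul_le_iff₀ hR1]; linarith
    have := le_max_right (-c) (1 - m)
    linarith
  · have hpos' : 0 < ‖x - x₀‖ := hR1.trans h
    have hbound : ((c + 1 / (R + 1) * ‖x - x₀‖ : ℝ) : EReal) ≤ ψ x := by
      by_contra! hlt
      -- This picks the point of the segment at distance `R + 1` from `x₀`. Convexity would put it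
      -- in the sublevel set at `c + 1`, which lies within radius `R`.
      set t := (R + 1) / ‖x - x₀‖ with ht
      have ht0 : 0 ≤ t := by positivity
      have ht1 : t ≤ 1 := (div_le_one hpos').2 h.le
      have hz := hψ.le_combo hx₀ hlt.le (sub_nonneg.2 ht1) ht0 (by ring)
      have hval : (1 - t) * c + t * (c + 1 / (R + 1) * ‖x - x₀‖) = c + 1 := by
        rw [ht]; field_simp; ring
      rw [hval] at hz
      have hmem := hsub hz
      rw [Metric.mem_closedBall, dist_eq_norm] at hmem
      have e : (1 - t) • x₀ + t • x - x₀ = t • (x - x₀) := by module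
      rw [e, norm_smul, Real.norm_eq_abs, abs_of_nonneg ht0, ht, div_mul_cancel₀ _ hpos'.ne'] at hmem
      linarith
    refine le_trans (EReal.coe_le_coe_iff.2 ?_) hbound
    have := le_max_left (-c) (1 - m)
    linarith

/-! ### The Moreau-Yosida envelope and its normalizing constant. -/

lemma moreauEnvelope_le (ψ : EuclideanSpace ℝ (Fin d) → EReal) (lam : ℝ)
    (x : EuclideanSpace ℝ (Fin d)) : moreauEnvelope ψ lam x ≤ ψ x := by
  refine (iInf_le _ x).trans ?_
  simp

lemma IsProperClosedConvex.moreauEnvelope_ne_top (hψ : IsProperClosedConvex ψ) (lam : ℝ)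
    (x : EuclideanSpace ℝ (Fin d)) : moreauEnvelope ψ lam x ≠ ⊤ := by
  obtain ⟨y, hy⟩ := hψ.exists_ne_top
  refine ne_top_of_le_ne_top ?_ (iInf_le _ y)
  exact EReal.add_ne_top hy (EReal.coe_ne_top _)

/-- An infimum of continuous functions of `x` is upper semicontinuous, even over uncountably many
`y`. -/
lemma IsProperClosedConvex.measurable_moreauEnvelope (hψ : IsProperClosedConvex ψ) (lam : ℝ) :
    Measurable (moreauEnvelope ψ lam) := by
  refine (upperSemicontinuous_iInf fun y => Continuous.upperSemicontinuous ?_).measurable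
  rw [continuous_iff_continuousAt]
  intro x
  refine ContinuousAt.comp (f := fun x => (ψ y, ((‖y - x‖ ^ 2 / (2 * lam) : ℝ) : EReal)))
    (g := fun p : EReal × EReal => p.1 + p.2)
    (EReal.continuousAt_add (Or.inr (EReal.coe_ne_bot _)) (Or.inl (hψ.ne_bot y))) ?_
  refine continuousAt_const.prodMk (Continuous.continuousAt ?_)
  exact continuous_coe_real_ereal.comp (by fun_prop)

/-- Young's inequality `a s ≤ s² / (2 lam) + a² lam / 2` with `s = ‖y - x‖`: the slope survives and
only the intercept drops. -/
lemma linear_le_moreauEnvelope {lam : ℝ} (hlam : 0 < lam) {a b : ℝ}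
    {x₀ : EuclideanSpace ℝ (Fin d)} (ha : 0 < a)
    (h : ∀ x, ((a * ‖x - x₀‖ - b : ℝ) : EReal) ≤ ψ x) (x : EuclideanSpace ℝ (Fin d)) :
    ((a * ‖x - x₀‖ - (b + a ^ 2 * lam / 2) : ℝ) : EReal) ≤ moreauEnvelope ψ lam x := by
  refine le_iInf fun y => le_trans ?_ (add_le_add_left (h y) _)
  rw [← EReal.coe_add, EReal.coe_le_coe_iff]
  have htri : ‖x - x₀‖ ≤ ‖y - x‖ + ‖y - x₀‖ := by
    rw [← norm_sub_rev x y]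
    exact norm_sub_le_norm_sub_add_norm_sub x y x₀
  have hsq : a * ‖y - x‖ - a ^ 2 * lam / 2 ≤ ‖y - x‖ ^ 2 / (2 * lam) := by
    rw [le_div_iff₀ (by positivity)]
    nlinarith [sq_nonneg (‖y - x‖ - a * lam)]
  nlinarith

lemma integrable_exp_neg_mul_norm_sub {a : ℝ} (ha : 0 < a) (x₀ : EuclideanSpace ℝ (Fin d)) :
    Integrable fun x : EuclideanSpace ℝ (Fin d) => Real.exp (-(a * ‖x - x₀‖)) := by
  have hint : Integrable fun x : EuclideanSpace ℝ (Fin d) => (1 + ‖x‖) ^ (-((d : ℝ) + 1)) :=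
    integrable_one_add_norm (by simp)
  have h0 : Integrable fun x : EuclideanSpace ℝ (Fin d) => Real.exp (-(a * ‖x‖)) := by
    -- The constant comes from `uᵏ / k! ≤ eᵘ` at `u = a (1 + ‖x‖)`, `k = d + 1`, the first integer
    -- power integrable in dimension `d`.
    refine (hint.const_mul ((d + 1).factorial * Real.exp a / a ^ (d + 1))).mono'
      (by fun_prop) (ae_of_all _ fun x => ?_)
    have hx : 0 < 1 + ‖x‖ := by positivity
    have hexp := Real.pow_div_factorial_le_exp (x := a * (1 + ‖x‖)) (by positivity) (d + 1)
    rw [Real.norm_eq_abs, abs_of_pos (Real.exp_pos _), Real.rpow_neg hx.le, Real.exp_neg]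
    have e : (1 + ‖x‖) ^ ((d : ℝ) + 1) = (1 + ‖x‖) ^ (d + 1) := by
      rw [← Real.rpow_natCast]; push_cast; rfl
    rw [e, ← div_eq_mul_inv, div_div, inv_eq_one_div, div_le_div_iff₀ (Real.exp_pos _)
      (by positivity)]
    rw [div_le_iff₀ (by positivity), mul_pow, mul_add, Real.exp_add, mul_one] at hexp
    linarith
  exact h0.comp_sub_right x₀

lemma IsProperClosedConvex.normConst_moreauEnvelope_lt_top (hψ : IsProperClosedConvex ψ)
    (hpos : 0 < normConst ψ) (hfin : normConst ψ < ⊤) {lam : ℝ} (hlam : 0 < lam) :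
    normConst (moreauEnvelope ψ lam) < ⊤ := by
  obtain ⟨a, b, x₀, ha, h⟩ := hψ.exists_linear_lower_bound hpos hfin
  have hlow := linear_le_moreauEnvelope hlam ha h
  set b' := b + a ^ 2 * lam / 2
  refine lt_of_le_of_lt (lintegral_mono fun x => ?_)
    ((integrable_exp_neg_mul_norm_sub ha x₀).const_mul (Real.exp b')).lintegral_lt_top
  refine (EReal.exp_monotone (EReal.neg_le_neg_iff.2 (hlow x))).trans ?_
  rw [← EReal.coe_neg, EReal.exp_coe, ← Real.exp_add]
  refine ENNReal.ofReal_le_ofReal (Real.exp_le_exp.2 ?_)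
  linarith

lemma normConst_moreauEnvelope_pos (hpos : 0 < normConst ψ) (lam : ℝ) :
    0 < normConst (moreauEnvelope ψ lam) :=
  hpos.trans_le (lintegral_mono fun x =>
    EReal.exp_monotone (EReal.neg_le_neg_iff.2 (moreauEnvelope_le ψ lam x)))

lemma IsProperClosedConvex.moreauEnvelope_ne_bot (hψ : IsProperClosedConvex ψ)
    (hpos : 0 < normConst ψ) (hfin : normConst ψ < ⊤) {lam : ℝ} (hlam : 0 < lam)
    (x : EuclideanSpace ℝ (Fin d)) : moreauEnvelope ψ lam x ≠ ⊥ := by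
  obtain ⟨a, b, x₀, ha, h⟩ := hψ.exists_linear_lower_bound hpos hfin
  exact ne_bot_of_le_ne_bot (EReal.coe_ne_bot _) (linear_le_moreauEnvelope hlam ha h x)

/-! ### Gibbs measures and importance weights. -/

lemma isProbabilityMeasure_gibbs {φ : EuclideanSpace ℝ (Fin d) → EReal} (hφ : Measurable φ)
    (hpos : 0 < normConst φ) (hfin : normConst φ < ⊤) : IsProbabilityMeasure (gibbs φ) := by
  constructor
  rw [gibbs, withDensity_apply _ MeasurableSet.univ, Measure.restrict_univ]
  simp only [div_eq_mul_inv]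
  rw [lintegral_mul_const _ (measurable_exp_neg hφ)]
  exact ENNReal.mul_inv_cancel hpos.ne' hfin.ne

lemma IsProperClosedConvex.measurable_weight_ennreal (hψ : IsProperClosedConvex ψ) (lam : ℝ) :
    Measurable fun x => EReal.exp (-ψ x) / EReal.exp (-moreauEnvelope ψ lam x) :=
  (measurable_exp_neg hψ.measurable).div
    (measurable_exp_neg (hψ.measurable_moreauEnvelope lam))

lemma IsProperClosedConvex.measurable_weight (hψ : IsProperClosedConvex ψ) (lam : ℝ) :
    Measurable (weight ψ lam) :=
  (hψ.measurable_weight_ennreal lam).ennreal_toReal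

/-- The factor `e^{-ψ^lam}` cancels pointwise because the envelope is finite everywhere. -/
lemma IsProperClosedConvex.gibbs_withDensity_weight (hψ : IsProperClosedConvex ψ)
    (hpos : 0 < normConst ψ) (hfin : normConst ψ < ⊤) {lam : ℝ} (hlam : 0 < lam) :
    (gibbs (moreauEnvelope ψ lam)).withDensity
        (fun x => EReal.exp (-ψ x) / EReal.exp (-moreauEnvelope ψ lam x)) =
      (normConst ψ / normConst (moreauEnvelope ψ lam)) • gibbs ψ := by
  have hme := measurable_exp_neg hψ.measurable
  have hmel := measurable_exp_neg (hψ.measurable_moreauEnvelope lam)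
  rw [gibbs, gibbs, ← withDensity_mul _ (hmel.div_const _) (hψ.measurable_weight_ennreal lam),
    ← withDensity_smul _ (hme.div_const _)]
  congr 1
  funext x
  simp only [Pi.mul_apply, Pi.smul_apply, smul_eq_mul]
  have h1 : EReal.exp (-moreauEnvelope ψ lam x) ≠ 0 := by
    simpa using hψ.moreauEnvelope_ne_top lam x
  have h2 : EReal.exp (-moreauEnvelope ψ lam x) ≠ ⊤ := by
    simpa using hψ.moreauEnvelope_ne_bot hpos hfin hlam x
  simp only [div_eq_mul_inv]
  calc _ = EReal.exp (-moreauEnvelope ψ lam x) * (EReal.exp (-moreauEnvelope ψ lam x))⁻¹ *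
        (EReal.exp (-ψ x) * (normConst (moreauEnvelope ψ lam))⁻¹) := by ring
    _ = normConst ψ * (normConst ψ)⁻¹ *
        (EReal.exp (-ψ x) * (normConst (moreauEnvelope ψ lam))⁻¹) := by
      rw [ENNReal.mul_inv_cancel h1 h2, ENNReal.mul_inv_cancel hpos.ne' hfin.ne]
    _ = _ := by ring

/-- Importance sampling identity. -/
lemma IsProperClosedConvex.integral_mul_weight (hψ : IsProperClosedConvex ψ)
    (hpos : 0 < normConst ψ) (hfin : normConst ψ < ⊤) {lam : ℝ} (hlam : 0 < lam)
    (f : EuclideanSpace ℝ (Fin d) → ℝ) :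
    ∫ x, f x * weight ψ lam x ∂(gibbs (moreauEnvelope ψ lam)) =
      (normConst ψ / normConst (moreauEnvelope ψ lam)).toReal * ∫ x, f x ∂(gibbs ψ) := by
  have hlt : ∀ x, EReal.exp (-ψ x) / EReal.exp (-moreauEnvelope ψ lam x) < ⊤ := fun x =>
    ENNReal.div_lt_top (by simpa using hψ.ne_bot x)
      (by simpa using hψ.moreauEnvelope_ne_top lam x)
  have h := integral_withDensity_eq_integral_toReal_smul
    (μ := gibbs (moreauEnvelope ψ lam)) (hψ.measurable_weight_ennreal lam) (ae_of_all _ hlt) f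
  rw [hψ.gibbs_withDensity_weight hpos hfin hlam, integral_smul_measure, smul_eq_mul] at h
  rw [h]
  exact integral_congr_ae (ae_of_all _ fun x => mul_comm _ _)

end Convexity

end MYIS

end

/-! ### Consistency of the plug-in estimator. -/

theorem mainTheorem5 {d p : ℕ}
    (ψ : EuclideanSpace ℝ (Fin d) → EReal) (hψ : MYIS.IsProperClosedConvex ψ)
    (hpos : 0 < MYIS.normConst ψ) (hfin : MYIS.normConst ψ < ⊤)
    (lam : ℝ) (hlam : 0 < lam)
    (ξ : EuclideanSpace ℝ (Fin d) → EuclideanSpace ℝ (Fin p)) (hξ : Measurable ξ)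
    (hξint : Integrable ξ (MYIS.gibbs ψ))
    (κ : Kernel (EuclideanSpace ℝ (Fin d)) (EuclideanSpace ℝ (Fin d))) [IsMarkovKernel κ]
    (hstat : κ.Invariant (MYIS.gibbs (MYIS.moreauEnvelope ψ lam)))
    (hirr : MYIS.IsIrreducibleChain κ)
    (haper : MYIS.IsAperiodicChain κ (MYIS.gibbs (MYIS.moreauEnvelope ψ lam)))
    (hharris : MYIS.IsHarrisRecurrent κ (MYIS.gibbs (MYIS.moreauEnvelope ψ lam)))
    (Sig : Matrix (Fin p ⊕ Unit) (Fin p ⊕ Unit) ℝ)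
    (hSig : MYIS.IsAsymptoticCov κ (MYIS.gibbs (MYIS.moreauEnvelope ψ lam))
      (MYIS.statS ψ lam ξ) Sig)
    {Ω : Type*} [MeasurableSpace Ω] (P : Measure Ω) [IsProbabilityMeasure P]
    (X : ℕ → Ω → EuclideanSpace ℝ (Fin d)) (hX : MYIS.IsMarkovChain P κ X)
    (SigHat : ℕ → Ω → Matrix (Fin p ⊕ Unit) (Fin p ⊕ Unit) ℝ)
    (hSigHat : MYIS.StronglyConsistent P SigHat Sig) :
    MYIS.StronglyConsistent P
      (fun n ω => MYIS.plugIn ψ lam ξ n (fun t => X t ω) (SigHat n ω))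
      (MYIS.limitCov ψ lam ξ Sig) := by
  have hposl := MYIS.normConst_moreauEnvelope_pos hpos lam
  have hfinl := hψ.normConst_moreauEnvelope_lt_top hpos hfin hlam
  have := MYIS.isProbabilityMeasure_gibbs (hψ.measurable_moreauEnvelope lam) hposl hfinl
  have := MYIS.isProbabilityMeasure_gibbs hψ.measurable hpos hfin
  set v := (MYIS.normConst ψ / MYIS.normConst (MYIS.moreauEnvelope ψ lam)).toReal with hv
  have hv0 : v ≠ 0 := by
    rw [hv, ENNReal.toReal_ne_zero]
    exact ⟨ENNReal.div_ne_zero.2 ⟨hpos.ne', hfinl.ne⟩, (ENNReal.div_lt_top hfin.ne hposl.ne').ne⟩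
  have hw := hψ.measurable_weight lam
  -- The second moments of `S` supply the integrability that the strong law needs, here and for `ξ
  -- w`.
  have hwint : Integrable (MYIS.weight ψ lam) (MYIS.gibbs (MYIS.moreauEnvelope ψ lam)) :=
    (hSig.memLp (Sum.inr ())).integrable one_le_two
  have hmean : ∫ x, MYIS.weight ψ lam x ∂(MYIS.gibbs (MYIS.moreauEnvelope ψ lam)) = v := by
    simpa only [one_mul, integral_const, probReal_univ, smul_eq_mul, mul_one] using
      hψ.integral_mul_weight hpos hfin hlam fun _ => 1
  have hξi : ∀ i, Measurable fun x => ξ x i := fun i => by fun_prop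
  have hξwint : ∀ i, Integrable (fun x => ξ x i * MYIS.weight ψ lam x)
      (MYIS.gibbs (MYIS.moreauEnvelope ψ lam)) := fun i =>
    (hSig.memLp (Sum.inl i)).integrable one_le_two
  have hξmean : ∀ i, ∫ x, ξ x i * MYIS.weight ψ lam x ∂(MYIS.gibbs (MYIS.moreauEnvelope ψ lam)) =
      v * MYIS.targetMean ψ ξ i := fun i => by
    rw [hψ.integral_mul_weight hpos hfin hlam fun x => ξ x i]
    congr 1
    exact (EuclideanSpace.proj (𝕜 := ℝ) i).integral_comp_comm hξint
  have hlim1 := hX.ae_tendsto_average hharris hstat hw hwint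
  have hlim2 := ae_all_iff.2 fun i =>
    hX.ae_tendsto_average hharris hstat (f := fun x => ξ x i * MYIS.weight ψ lam x) ((hξi i).mul hw) (hξwint i)
  simp only [hmean, hξmean] at hlim1 hlim2
  filter_upwards [hlim1, hlim2, hSigHat] with ω h1 h2 h3
  have hθ : ∀ i, Tendsto (fun n => MYIS.thetaMY ψ lam ξ n (fun t => X t ω) i) atTop
      (𝓝 (MYIS.targetMean ψ ξ i)) := fun i => by
    have := (h2 i).div h1 hv0
    rw [mul_div_cancel_left₀ _ hv0] at this
    refine this.congr' ?_
    -- For `n ≠ 0` the factors `1 / n` cancel, so the self-normalized estimator is a quotient of two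
    -- averages.
    filter_upwards [eventually_ne_atTop 0] with n hn
    simp only [Pi.div_apply]
    rw [mul_div_mul_left _ _ (inv_ne_zero (Nat.cast_ne_zero.2 hn)), MYIS.thetaMY, Finset.sum_div]
    simp only [WithLp.ofLp_sum, Finset.sum_apply, PiLp.smul_apply, smul_eq_mul]
    exact Finset.sum_congr rfl fun t _ => by ring
  have hblock : Tendsto (fun n => MYIS.blockRow (MYIS.thetaMY ψ lam ξ n (fun t => X t ω))) atTop
      (𝓝 (MYIS.blockRow (MYIS.targetMean ψ ξ))) := by
    refine tendsto_pi_nhds.2 fun i => tendsto_pi_nhds.2 fun j => ?_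
    cases j with
    | inl j => simp only [MYIS.blockRow, Matrix.fromCols_apply_inl]; exact tendsto_const_nhds
    | inr j => simpa [MYIS.blockRow] using (hθ i).neg
  simp only [MYIS.plugIn, MYIS.limitCov, MYIS.sandwich, hmean]
  refine Tendsto.smul ?_ ?_
  · exact tendsto_const_nhds.div (h1.pow 2) (pow_ne_zero 2 hv0)
  · have hc : Continuous fun q : Matrix (Fin p) (Fin p ⊕ Unit) ℝ ×
        Matrix (Fin p ⊕ Unit) (Fin p ⊕ Unit) ℝ => q.1 * q.2 * q.1.transpose := by fun_prop
    have := (hc.tendsto (MYIS.blockRow (MYIS.targetMean ψ ξ), Sig)).comp (hblock.prodMk_nhds h3)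
    exact this
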